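/- Let $m,n\ge 1$ and $d\ge 0$ be integers, let $G_\phi,W_2,R_X\ge 0$ and $B$ be real numbers, and let $0<\delta<1$. Let $\mathcal X=\{X\in\mathbb R^{m\times d}:\ \|X_j\|_2\le R_X \text{ for every row } X_j,\ j=1,\dots,m\}$, let $\mathcal Y\subseteq\mathbb R^m$, and let $\mathcal F_2=\{w\in\mathbb R^d:\ \|w\|_2\le W_2\}$, where $w$ is identified with the linear scoring function $X\mapsto Xw$. Let $\phi:\mathbb R^m\times\mathcal Y\to[0,\infty)$ be a measurable loss that is Lipschitz in the score vector with respect to $\|\cdot\|_\infty$ with constant $G_\phi$, i.e. $|\phi(s,y)-\phi(s',y)|\le G_\phi\|s-s'\|_\infty$ for all $s,s'\in\mathbb R^m$, $y\in\mathcal Y$, and that is bounded by $B$ over $\mathcal F_2$, i.e. $\phi(Xw,y)\le B$ for all $X\in\mathcal X$, $y\in\mathcal Y$, $w\in\mathcal F_2$. Let $D$ be a probability distribution on $\mathcal X\times\mathcal Y$, let $(X^{(1)},y^{(1)}),\dots,(X^{(n)},y^{(n)})$ be drawn i.i.d. from $D$, and put $$L_\phi(w)=\mathbb E_{(X,y)\sim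 D}\,\phi(Xw,y),\qquad \hat L_\phi(w)=\frac1n\sum_{i=1}^n\phi(X^{(i)}w,y^{(i)}).$$ Write $\log^+x=\max(0,\log x)$ and $$\varepsilon_n(\delta)=G_\phi W_2R_X\sqrt{\frac{1}{n}}\;\sqrt{\log(3mn)}\,\Bigl(1+\log^+\frac{B\sqrt n}{G_\phi W_2R_X\sqrt{\log(3mn)}}\Bigr)+B\sqrt{\frac{\log(1/\delta)}{n}},$$ where the first summand is read as $0$ if $G_\phi W_2R_X=0$. Thus $\varepsilon_n(\delta)=\tilde O\bigl(G_\phi W_2R_X\sqrt{1/n}+B\sqrt{\log(1/\delta)/n}\bigr)$, where $\tilde O$ hides only these logarithmic factors; the list length $m$ enters only through $\log(3mn)$. There is a universal constant $C>0$ (independent of $m,d,n,G_\phi,W_2,R_X,B,\delta,\mathcal Y,\phi,D$) such that, in every such situation: 1. With probability at least $1-\delta$, for all $w\in\mathcal F_2$ simultaneously, $L_\phi(w)\le\hat L_\phi(w)+C\,\varepsilon_n(\delta)$. 2. $L_\phi$ has a minimizer over $\mathcal F_2$, and so does $\hat L_\phi$ for every sample. With probability at least $1-2\delta$, every empirical risk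 minimizer $\hat w$ (minimizer of $\hat L_\phi$ over $\mathcal F_2$) and every minimizer $w^\star$ of $L_\phi$ over $\mathcal F_2$ satisfy $L_\phi(\hat w)\le L_\phi(w^\star)+C\,\varepsilon_n(\delta)$. -/

import Mathlib

namespace LTR

noncomputable section

/-- The input space: `m × d` real matrices, given by their rows `X j ∈ ℝ^d`, all of whose rows
have Euclidean norm at most `R`. -/
def inputSpace (m d : ℕ) (R : ℝ) : Set (Fin m → EuclideanSpace ℝ (Fin d)) :=
  {X | ∀ j : Fin m, ‖X j‖ ≤ R}

/-- The weight vectors parametrizing the class `F₂`: the Euclidean ball `‖w‖₂ ≤ W`. -/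
def weightBall (d : ℕ) (W : ℝ) : Set (EuclideanSpace ℝ (Fin d)) :=
  {w | ‖w‖ ≤ W}

/-- The space of labelled examples `(X, y)`, with `X` in the input space and `y` in the label
space `Y ⊆ ℝ^m`. It carries the σ-algebra induced by the Borel one. -/
abbrev LabelledExample (m d : ℕ) (R : ℝ) (Y : Set (Fin m → ℝ)) : Type :=
  inputSpace m d R × Y

/-- The score vector `X w ∈ ℝ^m` of the linear scoring function with weights `w`; its `j`-th entry
is the inner product `⟨X j, w⟩`. -/
def score {m d : ℕ} (X : Fin m → EuclideanSpace ℝ (Fin d)) (w : EuclideanSpace ℝ (Fin d)) :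
    Fin m → ℝ :=
  fun j => inner ℝ (X j) w

/-- The loss `φ(X w, y)` of the weights `w` on the example `(X, y)`. -/
def lossAt {m d : ℕ} {R : ℝ} {Y : Set (Fin m → ℝ)} (φ : (Fin m → ℝ) → Y → ℝ)
    (w : EuclideanSpace ℝ (Fin d)) (z : LabelledExample m d R Y) : ℝ :=
  φ (score z.1.1 w) z.2

/-- The expected loss `L_φ(w) = E_{(X,y) ∼ D} φ(X w, y)`. -/
def risk {m d : ℕ} {R : ℝ} {Y : Set (Fin m → ℝ)} (φ : (Fin m → ℝ) → Y → ℝ)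
    (D : MeasureTheory.Measure (LabelledExample m d R Y)) (w : EuclideanSpace ℝ (Fin d)) : ℝ :=
  ∫ z, lossAt φ w z ∂D

/-- The empirical loss `(1/n) ∑ i, φ(X⁽ⁱ⁾ w, y⁽ⁱ⁾)` of `w` on the sample `S`. -/
def empRisk {m d n : ℕ} {R : ℝ} {Y : Set (Fin m → ℝ)} (φ : (Fin m → ℝ) → Y → ℝ)
    (S : Fin n → LabelledExample m d R Y) (w : EuclideanSpace ℝ (Fin d)) : ℝ :=
  (1 / (n : ℝ)) * ∑ i, lossAt φ w (S i)

/-- `w` minimizes `L` over the ball `‖w‖₂ ≤ W`. -/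
def IsBallMinimizer {d : ℕ} (W : ℝ) (L : EuclideanSpace ℝ (Fin d) → ℝ)
    (w : EuclideanSpace ℝ (Fin d)) : Prop :=
  w ∈ weightBall d W ∧ IsMinOn L (weightBall d W) w

/-- `G W R √(1/n) + B √(log(1/δ)/n)` with its logarithmic factors written out: the first summand
carries the factors `√(log(3mn))` and `1 + log⁺ (B √n / (G W R √(log(3mn))))`. -/
def complexityTerm (m n : ℕ) (G W R B δ : ℝ) : ℝ :=
  G * W * R * √(1 / (n : ℝ)) * √(Real.log (3 * m * n)) *
      (1 + Real.posLog (B * √(n : ℝ) / (G * W * R * √(Real.log (3 * m * n))))) +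
    B * √(Real.log (1 / δ) / n)

end

end LTR

/-! The dimension `d` never enters because weights are compared by Gaussian smoothing rather than by
covering. Replacing `w` by `w + s • g`, with `g` standard Gaussian, moves the scores by `s` times
`m` Gaussian variables of standard deviation at most `R`. Their expected sup norm is at most `R √(2
log(2m))` (`integral_norm_inner_le`), so smoothing changes a `G`-Lipschitz loss by at most `a s`,
where `a` is of order `G R √(log(3mn))`.

For a smoothed class bounded by `b`, PAC-Bayes with prior `N(0, s²)` and posterior `N(w, s²)` has
divergence `‖w‖² / (2 s²)`. It bounds the deviation, uniformly over the ball, by `b (W/s + √(2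
log(1/δ))) / √n` (`IsBddMeas.dev_smooth_le`, `measure_sum_dev_smooth_le`). At a single bandwidth,
balancing this against the bias `a s` gives only the rate `n^(-1/4)`.

The remedy is chaining over dyadic bandwidths (`measure_dev_multiscale_le`). The difference of two
consecutive smoothings is again made of smoothed functions, now of size `a s`
(`IsBddMeas.dev_smooth_sub_dev_smooth`). Each scale thus costs about `a W / √n`, whatever `s` is,
and the number of scales is the `log⁺` factor. The confidence terms decay geometrically.

For the excess risk, the uniform bound at the empirical minimizer is combined with Hoeffding's
inequality at one fixed population minimizer. -/

namespace LTR

open MeasureTheory ProbabilityTheory Real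

/-! ### Standard Gaussian measure: Cameron–Martin shift and maximal inequality. -/

section Gaussian

set_option linter.unusedSectionVars false

variable {E : Type*} [NormedAddCommGroup E] [InnerProductSpace ℝ E] [FiniteDimensional ℝ E]
  [MeasurableSpace E] [BorelSpace E]

/-- The density of the standard Gaussian measure with respect to the volume. -/
noncomputable def gaussDensity (E : Type*) [NormedAddCommGroup E] [InnerProductSpace ℝ E] (x : E) :
    ℝ :=
  ((2 * π) ^ (Module.finrank ℝ E / 2 : ℝ))⁻¹ * exp (-(1 / 2) * ‖x‖ ^ 2)

/-- The standard Gaussian measure, given by its density. -/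
noncomputable def gauss (E : Type*) [NormedAddCommGroup E] [InnerProductSpace ℝ E]
    [FiniteDimensional ℝ E] [MeasurableSpace E] [BorelSpace E] : Measure E :=
  (volume : Measure E).withDensity fun x => ENNReal.ofReal (gaussDensity E x)

lemma gaussDensity_pos (x : E) : 0 < gaussDensity E x := by
  unfold gaussDensity; positivity

lemma measurable_gaussDensity : Measurable (gaussDensity E) := by
  unfold gaussDensity; fun_prop

lemma integral_gaussDensity : ∫ x : E, gaussDensity E x = 1 := by
  unfold gaussDensity
  rw [integral_const_mul, GaussianFourier.integral_rexp_neg_mul_sq_norm (by norm_num),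
    show π / (1 / 2) = 2 * π by ring]
  exact inv_mul_cancel₀ (by positivity)

lemma integrable_gaussDensity : Integrable (gaussDensity E) :=
  Integrable.of_integral_ne_zero (by rw [integral_gaussDensity]; exact one_ne_zero)

instance isProbabilityMeasure_gauss : IsProbabilityMeasure (gauss E) := by
  refine ⟨?_⟩
  rw [gauss, withDensity_apply _ MeasurableSet.univ, Measure.restrict_univ,
    ← ofReal_integral_eq_lintegral_ofReal integrable_gaussDensity
      (ae_of_all _ fun x => (gaussDensity_pos x).le), integral_gaussDensity, ENNReal.ofReal_one]

lemma integral_gauss (f : E → ℝ) : ∫ x, f x ∂gauss E = ∫ x, gaussDensity E x * f x := by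
  rw [gauss, integral_withDensity_eq_integral_toReal_smul
    measurable_gaussDensity.ennreal_ofReal (by simp)]
  simp [ENNReal.toReal_ofReal (gaussDensity_pos _).le]

lemma integrable_gauss_iff (f : E → ℝ) :
    Integrable f (gauss E) ↔ Integrable fun x => gaussDensity E x * f x := by
  rw [gauss, integrable_withDensity_iff_integrable_smul'
    measurable_gaussDensity.ennreal_ofReal (by simp)]
  simp [ENNReal.toReal_ofReal (gaussDensity_pos _).le]

lemma gaussDensity_add (x v : E) :
    gaussDensity E (x + v) = gaussDensity E x * exp (-inner ℝ v x - ‖v‖ ^ 2 / 2) := by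
  unfold gaussDensity
  rw [mul_assoc, ← exp_add, norm_add_sq_real, real_inner_comm]
  ring_nf

/-- The Cameron–Martin formula. -/
lemma integral_gauss_shift (f : E → ℝ) (v : E) :
    ∫ x, exp (-inner ℝ v x - ‖v‖ ^ 2 / 2) * f (x + v) ∂gauss E = ∫ x, f x ∂gauss E := by
  rw [integral_gauss, integral_gauss,
    ← integral_add_right_eq_self (fun x => gaussDensity E x * f x) v]
  simp only [gaussDensity_add, mul_assoc]

lemma integrable_gauss_shift {f : E → ℝ} (hf : Integrable f (gauss E)) (v : E) :
    Integrable (fun x => exp (-inner ℝ v x - ‖v‖ ^ 2 / 2) * f (x + v)) (gauss E) := by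
  rw [integrable_gauss_iff] at hf ⊢
  simpa only [gaussDensity_add, mul_assoc] using hf.comp_add_right v

lemma integrable_exp_inner (v : E) : Integrable (fun x => exp (inner ℝ v x)) (gauss E) := by
  have h := (integrable_gauss_shift (integrable_const (1 : ℝ)) (-v)).mul_const
    (exp (‖v‖ ^ 2 / 2))
  refine h.congr (ae_of_all _ fun x => ?_)
  simp only [mul_one, inner_neg_left, norm_neg, neg_neg, ← exp_add]
  ring_nf

/-- Cameron–Martin for the constant function `1`, shifted by `-v`. -/
lemma integral_exp_inner (v : E) : ∫ x, exp (inner ℝ v x) ∂gauss E = exp (‖v‖ ^ 2 / 2) := by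
  have h := integral_gauss_shift (fun _ : E => (1 : ℝ)) (-v)
  simp only [mul_one, inner_neg_left, norm_neg, neg_neg, integral_const, probReal_univ,
    smul_eq_mul, exp_sub, integral_div] at h
  field_simp at h
  linarith

lemma integrable_inner (v : E) : Integrable (fun x => inner ℝ v x) (gauss E) := by
  refine ((integrable_exp_inner v).add (integrable_exp_inner (-v))).mono'
    (by fun_prop) (ae_of_all _ fun x => ?_)
  simp only [Pi.add_apply, inner_neg_left, norm_eq_abs]
  have h1 := add_one_le_exp (inner ℝ v x)
  have h2 := add_one_le_exp (-inner ℝ v x)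
  have h3 := exp_pos (inner ℝ v x)
  have h4 := exp_pos (-inner ℝ v x)
  rw [abs_le]
  constructor <;> linarith

lemma integral_inner_gauss (v : E) : ∫ x, inner ℝ v x ∂gauss E = 0 := by
  have h : ∫ x, inner ℝ v x ∂gauss E = -∫ x, inner ℝ v x ∂gauss E := by
    rw [← integral_neg, integral_gauss, integral_gauss, ← integral_neg_eq_self]
    simp [gaussDensity]
  linarith

lemma integrable_norm_inner {ι : Type*} [Fintype ι] (x : ι → E) :
    Integrable (fun g => ‖fun j => (inner ℝ (x j) g : ℝ)‖) (gauss E) := by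
  refine (integrable_finsetSum Finset.univ fun j _ => (integrable_inner (x j)).norm).mono'
    (continuous_pi fun j => by fun_prop).norm.aestronglyMeasurable (ae_of_all _ fun g => ?_)
  rw [norm_norm]
  refine (pi_norm_le_iff_of_nonneg (Finset.sum_nonneg fun j _ => norm_nonneg _)).2 fun j => ?_
  exact Finset.single_le_sum (f := fun j => ‖(inner ℝ (x j) g : ℝ)‖)
    (fun j _ => norm_nonneg _) (Finset.mem_univ j)

/-- The maximal inequality for finitely many Gaussian variables. -/
lemma integral_norm_inner_le {ι : Type*} [Fintype ι] [Nonempty ι] (x : ι → E) {R l : ℝ}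
    (hR : 0 < R) (hx : ∀ j, ‖x j‖ ≤ R) (hl : 0 < l) (hcard : log (2 * Fintype.card ι) ≤ l) :
    ∫ g, ‖fun j => (inner ℝ (x j) g : ℝ)‖ ∂gauss E ≤ R * √(2 * l) := by
  -- With `t R = √(2l)` each of the `2 |ι|` one-sided exponential moments is at most `exp l`. Since
  -- `2 |ι| ≤ exp l`, they sum to at most `exp (2l)`.
  set t := √(2 * l) / R with ht
  have hs : 0 < √(2 * l) := by positivity
  have hs2 : √(2 * l) ^ 2 = 2 * l := sq_sqrt (by positivity)
  have ht0 : 0 < t := by positivity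
  have htR : t * R = √(2 * l) := by rw [ht]; field_simp
  have hexp : ∀ v : E, ‖v‖ ≤ √(2 * l) → ∫ g, exp (inner ℝ v g) ∂gauss E ≤ exp l := by
    intro v hv
    rw [integral_exp_inner, exp_le_exp]
    nlinarith [norm_nonneg v]
  have hint : ∀ j, Integrable (fun g => exp (inner ℝ (t • x j) g) + exp (inner ℝ (-(t • x j)) g))
      (gauss E) := fun j => (integrable_exp_inner _).add (integrable_exp_inner _)
  -- The tangent to `exp` at `2l` replaces Jensen's inequality; after integration the right side is
  -- at most `2l`.
  have hpt : ∀ g : E, t * ‖fun j => (inner ℝ (x j) g : ℝ)‖ ≤ 2 * l - 1 +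
      exp (-(2 * l)) * ∑ j, (exp (inner ℝ (t • x j) g) + exp (inner ℝ (-(t • x j)) g)) := by
    intro g
    obtain ⟨j, hj⟩ : ∃ j, ‖fun j => (inner ℝ (x j) g : ℝ)‖ = ‖(inner ℝ (x j) g : ℝ)‖ := by
      obtain ⟨j, hj⟩ := Finite.exists_max fun j => ‖(inner ℝ (x j) g : ℝ)‖
      exact ⟨j, le_antisymm ((pi_norm_le_iff_of_nonneg (norm_nonneg _)).2 hj)
        (norm_le_pi_norm (fun j => (inner ℝ (x j) g : ℝ)) j)⟩
    rw [hj]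
    have h1 : exp (t * ‖(inner ℝ (x j) g : ℝ)‖) ≤
        ∑ j, (exp (inner ℝ (t • x j) g) + exp (inner ℝ (-(t • x j)) g)) := by
      refine le_trans ?_ (Finset.single_le_sum
        (f := fun j => exp (inner ℝ (t • x j) g) + exp (inner ℝ (-(t • x j)) g))
        (fun j _ => by positivity) (Finset.mem_univ j))
      simp only [inner_neg_left, real_inner_smul_left, norm_eq_abs]
      rcases abs_cases (inner ℝ (x j) g : ℝ) with ⟨h, _⟩ | ⟨h, _⟩ <;> rw [h]
      · exact le_add_of_nonneg_right (exp_pos _).le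
      · rw [mul_neg]; exact le_add_of_nonneg_left (exp_pos _).le
    have h2 := add_one_le_exp (-(2 * l) + t * ‖(inner ℝ (x j) g : ℝ)‖)
    rw [exp_add] at h2
    have h3 := mul_le_mul_of_nonneg_left h1 (exp_pos (-(2 * l))).le
    linarith
  have hmain := integral_mono ((integrable_norm_inner x).const_mul t)
    ((integrable_const _).add ((integrable_finsetSum _ fun j _ => hint j).const_mul _)) hpt
  rw [integral_const_mul, integral_add' (integrable_const _)
    ((integrable_finsetSum _ fun j _ => hint j).const_mul _), integral_const_mul,
    integral_finsetSum _ fun j _ => hint j] at hmain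
  have hsum : ∑ j, ∫ g, (exp (inner ℝ (t • x j) g) + exp (inner ℝ (-(t • x j)) g)) ∂gauss E ≤
      exp (2 * l) := by
    have hj : ∀ j ∈ Finset.univ, ∫ g, (exp (inner ℝ (t • x j) g) +
        exp (inner ℝ (-(t • x j)) g)) ∂gauss E ≤ 2 * exp l := by
      intro j _
      have hn : ‖t • x j‖ ≤ √(2 * l) := by
        rw [norm_smul, norm_of_nonneg ht0.le, ← htR]
        exact mul_le_mul_of_nonneg_left (hx j) ht0.le
      rw [integral_add (integrable_exp_inner _) (integrable_exp_inner _)]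
      linarith [hexp _ hn, hexp (-(t • x j)) (by rwa [norm_neg])]
    refine (Finset.sum_le_card_nsmul _ _ _ hj).trans ?_
    have hc : (2 * Fintype.card ι : ℝ) ≤ exp l :=
      (log_le_iff_le_exp (by positivity)).1 hcard
    rw [Finset.card_univ, nsmul_eq_mul, two_mul l, exp_add]
    nlinarith [exp_pos l]
  have hfin : exp (-(2 * l)) * ∑ j, ∫ g, (exp (inner ℝ (t • x j) g) +
      exp (inner ℝ (-(t • x j)) g)) ∂gauss E ≤ 1 := by
    refine (mul_le_mul_of_nonneg_left hsum (exp_pos _).le).trans ?_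
    rw [← exp_add]; simp
  simp only [integral_const, probReal_univ, smul_eq_mul, one_mul] at hmain
  have : t * ∫ g, ‖fun j => (inner ℝ (x j) g : ℝ)‖ ∂gauss E ≤ t * (R * √(2 * l)) := by
    rw [← mul_assoc, htR]
    nlinarith
  exact le_of_mul_le_mul_left this ht0

end Gaussian

/-! ### Deviations of a single bounded function. -/

section Deviation

set_option linter.unusedSectionVars false

variable {Z : Type*} [MeasurableSpace Z] {n : ℕ}

/-- The deviation of the sample mean of `f` from its expectation. -/
noncomputable def dev (D : Measure Z) (S : Fin n → Z) (f : Z → ℝ) : ℝ :=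
  ∫ z, f z ∂D - (1 / (n : ℝ)) * ∑ i, f (S i)

lemma integrable_of_abs_le {μ : Measure Z} [IsFiniteMeasure μ] {f : Z → ℝ} {b : ℝ}
    (hf : Measurable f) (hb : ∀ z, |f z| ≤ b) : Integrable f μ :=
  Integrable.of_bound hf.aestronglyMeasurable b (ae_of_all _ fun z => by simpa using hb z)

lemma abs_integral_le_of_abs_le {μ : Measure Z} [IsProbabilityMeasure μ] {f : Z → ℝ} {b : ℝ}
    (hb : ∀ z, |f z| ≤ b) : |∫ z, f z ∂μ| ≤ b := by
  simpa using norm_integral_le_of_norm_le_const (μ := μ) (f := f)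
    (ae_of_all _ fun z => by simpa using hb z)

lemma abs_mean_le {f : Z → ℝ} {b : ℝ} (hn : 1 ≤ n) (hb : ∀ z, |f z| ≤ b) (S : Fin n → Z) :
    |(1 / (n : ℝ)) * ∑ i, f (S i)| ≤ b := by
  have hn' : (0 : ℝ) < n := by exact_mod_cast hn
  have h : |∑ i, f (S i)| ≤ n * b := by
    refine (Finset.abs_sum_le_sum_abs _ _).trans ?_
    simpa using Finset.sum_le_card_nsmul Finset.univ (fun i => |f (S i)|) b fun i _ => hb _
  rw [abs_mul, abs_of_pos (by positivity), one_div, inv_mul_le_iff₀ hn']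
  exact h

lemma abs_dev_le {D : Measure Z} [IsProbabilityMeasure D] {f : Z → ℝ} {b : ℝ} (hn : 1 ≤ n)
    (hb : ∀ z, |f z| ≤ b) (S : Fin n → Z) : |dev D S f| ≤ 2 * b := by
  have h1 := abs_integral_le_of_abs_le (μ := D) hb
  have h2 := abs_mean_le hn hb S
  have h3 := abs_sub (∫ z, f z ∂D) ((1 / (n : ℝ)) * ∑ i, f (S i))
  unfold dev
  linarith

lemma dev_sub {D : Measure Z} {f g : Z → ℝ} (hf : Integrable f D)
    (hg : Integrable g D) (S : Fin n → Z) :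
    dev D S (fun z => f z - g z) = dev D S f - dev D S g := by
  simp only [dev, integral_sub hf hg, Finset.sum_sub_distrib]
  ring

lemma measurable_dev (D : Measure Z) {f : Z → ℝ} (hf : Measurable f) :
    Measurable fun S : Fin n → Z => dev D S f := by
  unfold dev; fun_prop

/-- Exponential moments of the deviation of a bounded function, by Hoeffding's lemma. -/
lemma integral_exp_dev_le (D : Measure Z) [IsProbabilityMeasure D] {f : Z → ℝ} {b : ℝ}
    (hn : 1 ≤ n) (hf : Measurable f) (hb : ∀ z, |f z| ≤ b) (t : ℝ) :
    ∫ S, exp (t * dev D S f - t ^ 2 * b ^ 2 / (2 * n)) ∂(Measure.pi fun _ : Fin n => D) ≤ 1 := by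
  have hn' : (0 : ℝ) < n := by exact_mod_cast hn
  -- The sign is flipped because `dev` is expectation minus sample mean.
  have hX := hasSubgaussianMGF_of_mem_Icc (μ := D) (X := fun z => -f z) (a := -b) (b := b)
    hf.neg.aemeasurable (ae_of_all _ fun z => by
      have := abs_le.1 (hb z)
      exact ⟨by linarith, by linarith⟩)
  have hmgf := hX.mgf_le (t / n)
  have hc : (((‖b - -b‖₊ / 2) ^ 2 : NNReal) : ℝ) = b ^ 2 := by
    push_cast
    rw [norm_eq_abs, div_pow, sq_abs]; ring
  rw [hc] at hmgf
  have hfac : ∀ S : Fin n → Z, exp (t * dev D S f - t ^ 2 * b ^ 2 / (2 * n)) =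
      exp (-(t ^ 2 * b ^ 2 / (2 * n))) *
        ∏ i, exp (t / n * (-f (S i) - ∫ z, -f z ∂D)) := by
    intro S
    rw [← exp_sum, ← exp_add, ← Finset.mul_sum, Finset.sum_sub_distrib, dev, integral_neg]
    congr 1
    simp only [Finset.sum_neg_distrib, Finset.sum_const, Finset.card_univ, Fintype.card_fin,
      nsmul_eq_mul]
    field_simp
    ring
  simp only [hfac]
  rw [integral_const_mul, integral_fintype_prod_eq_pow (fun z => exp (t / n * (-f z - ∫ z, -f z ∂D))),
    Fintype.card_fin]
  have h1 : (∫ z, exp (t / n * (-f z - ∫ z, -f z ∂D)) ∂D) ^ n ≤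
      exp (b ^ 2 * (t / n) ^ 2 / 2) ^ n :=
    pow_le_pow_left₀ (integral_nonneg fun z => (exp_pos _).le) hmgf n
  refine (mul_le_mul_of_nonneg_left h1 (exp_pos _).le).trans ?_
  rw [← exp_nat_mul, ← exp_add, exp_le_one_iff]
  apply le_of_eq
  field_simp
  ring

lemma measure_lt_le_of_integral_le {Ω : Type*} [MeasurableSpace Ω] {μ : Measure Ω}
    [IsProbabilityMeasure μ] {Y : Ω → ℝ} (hY : Integrable Y μ) (h0 : ∀ x, 0 ≤ Y x) {c δ : ℝ}
    (hc : 0 < c) (hδ : 0 < δ) (h : ∫ x, Y x ∂μ ≤ c) :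
    μ {x | c / δ < Y x} ≤ ENNReal.ofReal δ := by
  have h1 := mul_meas_ge_le_integral_of_nonneg (ae_of_all _ h0) hY (c / δ)
  have h2 : μ.real {x | c / δ ≤ Y x} ≤ δ := by
    have h3 : c / δ * μ.real {x | c / δ ≤ Y x} ≤ c / δ * δ := by
      rw [div_mul_cancel₀ _ hδ.ne']; exact h1.trans h
    exact le_of_mul_le_mul_left h3 (by positivity)
  refine (measure_mono (t := {x | c / δ ≤ Y x}) fun x (hx : c / δ < Y x) => hx.le).trans ?_
  rw [← ENNReal.ofReal_toReal (measure_ne_top μ {x | c / δ ≤ Y x})]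
  exact ENNReal.ofReal_le_ofReal h2

/-- Hoeffding's inequality for a single bounded function. -/
lemma measure_dev_gt_le (D : Measure Z) [IsProbabilityMeasure D] {f : Z → ℝ} {b δ : ℝ}
    (hn : 1 ≤ n) (hf : Measurable f) (hb : ∀ z, |f z| ≤ b) (hb0 : 0 ≤ b) (hδ : 0 < δ)
    (hδ' : δ < 1) :
    (Measure.pi fun _ : Fin n => D) {S | √2 * (b * √(log (1 / δ) / n)) < dev D S f} ≤
      ENNReal.ofReal δ := by
  rcases hb0.eq_or_lt with rfl | hb0
  · have h0 : ∀ S : Fin n → Z, ¬√2 * (0 * √(log (1 / δ) / n)) < dev D S f := fun S => by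
      have := le_of_abs_le (abs_dev_le (D := D) hn hb S)
      linarith
    simp only [h0]
    simp
  have hn' : (0 : ℝ) < n := by exact_mod_cast hn
  have hL : 0 < log (1 / δ) := log_pos (by rw [lt_div_iff₀ hδ]; linarith)
  set r := √(log (1 / δ) / n) with hr
  have hr0 : 0 < r := by positivity
  have hr2 : r ^ 2 * n = log (1 / δ) := by
    rw [hr, sq_sqrt (by positivity)]; field_simp
  have h2 : √2 ^ 2 = 2 := sq_sqrt (by norm_num)
  have h20 : 0 < √2 := by positivity
  -- The Chernoff optimum: it maximizes `t (√2 b r) - t² b² / (2n)`, with value `log (1/δ)`.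
  set t := √2 * r * n / b with ht
  have ht0 : 0 < t := by positivity
  have hint : Integrable (fun S : Fin n → Z => exp (t * dev D S f - t ^ 2 * b ^ 2 / (2 * n)))
      (Measure.pi fun _ : Fin n => D) := by
    refine integrable_of_abs_le (b := exp (t * (2 * b))) ?_ fun S => ?_
    · exact (((measurable_dev D hf).const_mul t).sub_const _).exp
    · rw [abs_exp, exp_le_exp]
      have h := le_of_abs_le (abs_dev_le (D := D) hn hb S)
      have h' : 0 ≤ t ^ 2 * b ^ 2 / (2 * n) := by positivity
      nlinarith
  refine (measure_mono fun S hS => ?_).trans (measure_lt_le_of_integral_le hint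
    (fun S => (exp_pos _).le) one_pos hδ (integral_exp_dev_le D hn hf hb t))
  simp only [Set.mem_ofPred_eq] at hS ⊢
  rw [← log_lt_iff_lt_exp (by positivity)]
  have h3 := mul_lt_mul_of_pos_left hS ht0
  have h4 : t * (√2 * (b * r)) = 2 * log (1 / δ) := by
    rw [ht, ← hr2]; field_simp; rw [h2]
  have h5 : t ^ 2 * b ^ 2 / (2 * n) = log (1 / δ) := by
    rw [ht, ← hr2]; field_simp; rw [h2]
  linarith

end Deviation

/-! ### Gaussian smoothing and the PAC-Bayes bound. -/

section PACBayes

variable {E : Type*} [NormedAddCommGroup E] [InnerProductSpace ℝ E] [FiniteDimensional ℝ E]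
  [MeasurableSpace E] [BorelSpace E] {Z : Type*} [MeasurableSpace Z] {n : ℕ}

/-- A jointly measurable family of functions that are bounded by `b` in absolute value. -/
def IsBddMeas (F : E → Z → ℝ) (b : ℝ) : Prop :=
  Measurable (Function.uncurry F) ∧ ∀ u z, |F u z| ≤ b

/-- Averaging over a Gaussian perturbation of the parameter. -/
noncomputable def smooth (s : ℝ) (F : E → Z → ℝ) (u : E) (z : Z) : ℝ :=
  ∫ g, F (u + s • g) z ∂gauss E

namespace IsBddMeas

set_option linter.unusedSectionVars false

variable {F F' : E → Z → ℝ} {b b' : ℝ}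

lemma measurable_comp (hF : IsBddMeas F b) {Ω : Type*} [MeasurableSpace Ω] {f : Ω → E} {g : Ω → Z}
    (hf : Measurable f) (hg : Measurable g) : Measurable fun x => F (f x) (g x) :=
  hF.1.comp (hf.prodMk hg)

lemma measurable_right (hF : IsBddMeas F b) (u : E) : Measurable (F u) :=
  hF.measurable_comp measurable_const measurable_id

lemma integrable_right (hF : IsBddMeas F b) (D : Measure Z) [IsFiniteMeasure D] (u : E) :
    Integrable (F u) D :=
  integrable_of_abs_le (hF.measurable_right u) (hF.2 u)

lemma integrable_left (hF : IsBddMeas F b) (s : ℝ) (u : E) (z : Z) :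
    Integrable (fun g => F (u + s • g) z) (gauss E) :=
  integrable_of_abs_le (hF.measurable_comp (by fun_prop) measurable_const) fun _ => hF.2 _ _

lemma sub (hF : IsBddMeas F b) (hF' : IsBddMeas F' b') {c : ℝ}
    (hc : ∀ u z, |F u z - F' u z| ≤ c) : IsBddMeas (fun u z => F u z - F' u z) c :=
  ⟨hF.1.sub hF'.1, hc⟩

lemma smoothed (hF : IsBddMeas F b) (s : ℝ) : IsBddMeas (smooth s F) b := by
  refine ⟨?_, fun u z => abs_integral_le_of_abs_le fun g => hF.2 _ _⟩
  have h : Measurable fun p : (E × Z) × E => F (p.1.1 + s • p.2) p.1.2 :=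
    hF.measurable_comp (by fun_prop) (by fun_prop)
  exact (h.stronglyMeasurable.integral_prod_right' (ν := gauss E)).measurable

lemma measurable_dev_comp (hF : IsBddMeas F b) (D : Measure Z) [IsProbabilityMeasure D]
    {Ω : Type*} [MeasurableSpace Ω] {f : Ω → E} {S : Ω → Fin n → Z}
    (hf : Measurable f) (hS : Measurable S) : Measurable fun x => dev D (S x) (F (f x)) := by
  unfold dev
  have h : Measurable fun p : Ω × Z => F (f p.1) p.2 :=
    hF.measurable_comp (by fun_prop) (by fun_prop)
  have h1 := (h.stronglyMeasurable.integral_prod_right' (ν := D)).measurable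
  have h2 : ∀ i, Measurable fun x => F (f x) (S x i) := fun i =>
    hF.measurable_comp hf ((measurable_pi_apply i).comp hS)
  exact h1.sub ((Finset.measurable_sum _ fun i _ => h2 i).const_mul _)

/-- By Fubini, the deviation of a smoothed function is a posterior average of deviations, which is
the quantity PAC-Bayes controls. -/
lemma dev_smooth (hF : IsBddMeas F b) (D : Measure Z) [IsProbabilityMeasure D] (S : Fin n → Z)
    (s : ℝ) (w : E) : dev D S (smooth s F w) = ∫ g, dev D S (F (w + s • g)) ∂gauss E := by
  unfold dev smooth
  have h : Measurable fun p : E × Z => F (w + s • p.1) p.2 :=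
    hF.measurable_comp (by fun_prop) (by fun_prop)
  have hint : Integrable (fun p : E × Z => F (w + s • p.1) p.2) ((gauss E).prod D) :=
    integrable_of_abs_le h fun _ => hF.2 _ _
  rw [integral_sub hint.integral_prod_left ((integrable_finsetSum _ fun i _ =>
    hF.integrable_left s w (S i)).const_mul _), integral_const_mul,
    integral_finsetSum _ fun i _ => hF.integrable_left s w (S i),
    integral_integral_swap (f := fun g z => F (w + s • g) z) hint]

lemma smooth_comm (hF : IsBddMeas F b) (s t : ℝ) :
    smooth s (smooth t F) = smooth t (smooth s F) := by
  funext u z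
  unfold smooth
  have h : Measurable fun p : E × E => F (u + s • p.1 + t • p.2) z :=
    hF.measurable_comp (by fun_prop) measurable_const
  rw [integral_integral_swap (f := fun g g' => F (u + s • g + t • g') z)
    (integrable_of_abs_le h fun _ => hF.2 _ _)]
  simp only [add_right_comm]

lemma smooth_sub (hF : IsBddMeas F b) (hF' : IsBddMeas F' b') (s : ℝ) (w : E) :
    smooth s (fun u z => F u z - F' u z) w =
      fun z => smooth s F w z - smooth s F' w z := by
  funext z
  exact integral_sub (hF.integrable_left s w z) (hF'.integrable_left s w z)

end IsBddMeas

/-- The exponential moment of the normalized deviation under the Gaussian prior. -/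
noncomputable def priorMoment (D : Measure Z) (F : E → Z → ℝ) (b s t : ℝ) (S : Fin n → Z) : ℝ :=
  ∫ g, exp (t * dev D S (F (s • g)) - t ^ 2 * b ^ 2 / (2 * n)) ∂gauss E

section

variable {F : E → Z → ℝ} {b : ℝ}

lemma IsBddMeas.integrable_exp_dev (hF : IsBddMeas F b) (D : Measure Z) [IsProbabilityMeasure D]
    {Ω : Type*} [MeasurableSpace Ω] (μ : Measure Ω) [IsProbabilityMeasure μ] {f : Ω → E}
    {S : Ω → Fin n → Z} (hn : 1 ≤ n) (hf : Measurable f) (hS : Measurable S) {t : ℝ} (ht : 0 < t) :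
    Integrable (fun x => exp (t * dev D (S x) (F (f x)) - t ^ 2 * b ^ 2 / (2 * n))) μ := by
  refine integrable_of_abs_le (b := exp (t * (2 * b))) ?_ fun x => ?_
  · exact (((hF.measurable_dev_comp D hf hS).const_mul t).sub_const _).exp
  · rw [abs_exp, exp_le_exp]
    have h := le_of_abs_le (abs_dev_le (D := D) hn (hF.2 (f x)) (S x))
    have h' : 0 ≤ t ^ 2 * b ^ 2 / (2 * n) := by positivity
    nlinarith

lemma IsBddMeas.integrable_priorMoment (hF : IsBddMeas F b) (D : Measure Z)
    [IsProbabilityMeasure D] (hn : 1 ≤ n) (s : ℝ) {t : ℝ} (ht : 0 < t) :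
    Integrable (priorMoment D F b s t) (Measure.pi fun _ : Fin n => D) :=
  (hF.integrable_exp_dev D ((Measure.pi fun _ : Fin n => D).prod (gauss E))
    (f := fun p => s • p.2) (S := fun p => p.1) hn (by fun_prop) (by fun_prop) ht).integral_prod_left

/-- The prior does not depend on the sample, so the integrals can be swapped and Hoeffding's lemma
applied at each fixed parameter. -/
lemma IsBddMeas.integral_priorMoment_le (hF : IsBddMeas F b) (D : Measure Z)
    [IsProbabilityMeasure D] (hn : 1 ≤ n) (s : ℝ) {t : ℝ} (ht : 0 < t) :
    ∫ S, priorMoment D F b s t S ∂(Measure.pi fun _ : Fin n => D) ≤ 1 := by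
  have hint := hF.integrable_exp_dev D ((Measure.pi fun _ : Fin n => D).prod (gauss E))
    (f := fun p => s • p.2) (S := fun p => p.1) hn (by fun_prop) (by fun_prop) ht
  unfold priorMoment
  rw [integral_integral_swap (f := fun (S : Fin n → Z) g =>
    exp (t * dev D S (F (s • g)) - t ^ 2 * b ^ 2 / (2 * n))) hint]
  calc _ ≤ ∫ _, (1 : ℝ) ∂gauss E := integral_mono hint.integral_prod_right (integrable_const _)
        fun g => integral_exp_dev_le D hn (hF.measurable_right (s • g)) (hF.2 (s • g)) t
    _ = 1 := by simp

/-- The PAC-Bayes change of measure from the centred Gaussian to the one with mean `w`. -/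
lemma IsBddMeas.dev_smooth_le (hF : IsBddMeas F b) (D : Measure Z)
    [IsProbabilityMeasure D] (hn : 1 ≤ n) {s t δ : ℝ} (hs : 0 < s) (ht : 0 < t) (hδ : 0 < δ)
    (S : Fin n → Z) (w : E) :
    t * dev D S (smooth s F w) ≤ ‖w‖ ^ 2 / (2 * s ^ 2) + t ^ 2 * b ^ 2 / (2 * n) +
      log (1 / δ) + (δ * priorMoment D F b s t S - 1) := by
  set v := s⁻¹ • w with hv
  set q := t ^ 2 * b ^ 2 / (2 * n) with hq
  have hvn : ‖v‖ ^ 2 / 2 = ‖w‖ ^ 2 / (2 * s ^ 2) := by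
    rw [hv, norm_smul, mul_pow, norm_inv, norm_of_nonneg hs.le]; field_simp
  have hsv : ∀ g, s • (g + v) = w + s • g := fun g => by
    rw [hv, smul_add, smul_inv_smul₀ hs.ne', add_comm]
  have hY := integral_gauss_shift (fun g : E => exp (t * dev D S (F (s • g)) - q)) v
  have hYi := integrable_gauss_shift (f := fun g : E => exp (t * dev D S (F (s • g)) - q))
    (hF.integrable_exp_dev D (gauss E) hn (by fun_prop) measurable_const ht) v
  simp only [hsv] at hY hYi
  have hdev : Integrable (fun g => dev D S (F (w + s • g))) (gauss E) :=
    integrable_of_abs_le (hF.measurable_dev_comp D (by fun_prop) measurable_const)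
      fun g => abs_dev_le hn (hF.2 _) S
  -- Here `x + 1 ≤ exp x` stands in for the Donsker–Varadhan formula. It leaves a remainder linear
  -- in the prior moment, so remainders of several classes can be added. The linear term integrates
  -- to `0`, and `‖v‖² / 2` is the divergence.
  have hpt : ∀ g : E, t * dev D S (F (w + s • g)) - inner ℝ v g ≤
      (‖v‖ ^ 2 / 2 + q + log (1 / δ) - 1) + δ * (exp (-inner ℝ v g - ‖v‖ ^ 2 / 2) *
        exp (t * dev D S (F (w + s • g)) - q)) := by
    intro g
    have h := add_one_le_exp (log δ + ((-inner ℝ v g - ‖v‖ ^ 2 / 2) +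
      (t * dev D S (F (w + s • g)) - q)))
    rw [exp_add, exp_log hδ, exp_add] at h
    rw [one_div, log_inv]
    linarith
  have hmain := integral_mono ((hdev.const_mul t).sub (integrable_inner v))
    ((integrable_const _).add (hYi.const_mul δ)) hpt
  rw [integral_add' (integrable_const _) (hYi.const_mul δ), integral_const_mul, hY,
    integral_sub' (hdev.const_mul t) (integrable_inner v), integral_const_mul,
    integral_inner_gauss,
    ← hF.dev_smooth, hvn] at hmain
  simp only [integral_const, probReal_univ, smul_eq_mul, one_mul] at hmain
  unfold priorMoment
  linarith

end

/-- A PAC-Bayes bound for finitely many function classes simultaneously, each with its own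
bandwidth, at a single confidence level. -/
theorem measure_sum_dev_smooth_le {ι : Type*} [Fintype ι] [Nonempty ι] (D : Measure Z)
    [IsProbabilityMeasure D] (hn : 1 ≤ n) (F : ι → E → Z → ℝ) (b s : ι → ℝ)
    (hF : ∀ i, IsBddMeas (F i) (b i)) (hb : ∀ i, 0 < b i) (hs : ∀ i, 0 < s i) {W δ : ℝ}
    (hW : 0 < W) (hδ : 0 < δ) (hδ' : δ < 1) :
    (Measure.pi fun _ : Fin n => D) {S | ¬ ∀ w : E, ‖w‖ ≤ W →
      ∑ i, dev D S (smooth (s i) (F i) w) ≤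
        ∑ i, b i * (W / s i + √(2 * log (1 / δ))) * √(1 / n)} ≤ ENNReal.ofReal δ := by
  have hn' : (0 : ℝ) < n := by exact_mod_cast hn
  have hL : 0 < log (1 / δ) := log_pos (by rw [lt_div_iff₀ hδ]; linarith)
  set r := √(1 / (n : ℝ)) with hr
  have hr0 : 0 < r := by positivity
  have hr2 : r ^ 2 * n = 1 := by
    rw [hr, sq_sqrt (by positivity)]; field_simp
  set L := √(2 * log (1 / δ)) with hLdef
  have hL2 : L ^ 2 = 2 * log (1 / δ) := sq_sqrt (by positivity)
  have hL0 : 0 < L := by positivity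
  set θ : ι → ℝ := fun i => W / s i + L with hθ
  have hθ0 : ∀ i, 0 < θ i := fun i => by have := hs i; simp only [hθ]; positivity
  -- This balances the bound: divergence plus confidence is at most `θ² / 2`, and the variance term
  -- equals `θ² / 2`.
  set t : ι → ℝ := fun i => n * r * θ i / b i with ht
  have ht0 : ∀ i, 0 < t i := fun i => by have := hb i; have := hθ0 i; simp only [ht]; positivity
  have hYint : ∀ i, Integrable (fun S => (t i)⁻¹ * priorMoment D (F i) (b i) (s i) (t i) S)
      (Measure.pi fun _ : Fin n => D) := fun i =>
    ((hF i).integrable_priorMoment D hn (s i) (ht0 i)).const_mul _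
  have hc : 0 < ∑ i, (t i)⁻¹ := Finset.sum_pos (fun i _ => inv_pos.2 (ht0 i)) Finset.univ_nonempty
  -- Weighting the moments by `(t i)⁻¹`, the factors left after dividing each bound by `t i`, makes
  -- the summed remainder nonpositive off one Markov event. No union bound over the classes is paid.
  refine (measure_mono fun S hS => ?_).trans (measure_lt_le_of_integral_le
    (Y := fun S => ∑ i, (t i)⁻¹ * priorMoment D (F i) (b i) (s i) (t i) S) (c := ∑ i, (t i)⁻¹)
    (integrable_finsetSum _ fun i _ => hYint i) (fun S => Finset.sum_nonneg fun i _ =>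
      mul_nonneg (inv_pos.2 (ht0 i)).le (integral_nonneg fun g => (exp_pos _).le)) hc hδ ?_)
  · by_contra hcon
    simp only [Set.mem_ofPred_eq, not_lt] at hS hcon
    apply hS
    intro w hw
    have hi : ∀ i, dev D S (smooth (s i) (F i) w) ≤ b i * θ i * r +
        (δ * ((t i)⁻¹ * priorMoment D (F i) (b i) (s i) (t i) S) - (t i)⁻¹) := by
      intro i
      have h := (hF i).dev_smooth_le D hn (hs i) (ht0 i) hδ S w
      have hbi := hb i
      have hsi := hs i
      have hti := ht0 i
      have h1 : ‖w‖ ^ 2 / (2 * s i ^ 2) ≤ (W / s i) ^ 2 / 2 := by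
        rw [div_pow, div_div, mul_comm (s i ^ 2) 2]
        gcongr
      have h2 : (W / s i) ^ 2 / 2 + log (1 / δ) ≤ θ i ^ 2 / 2 := by
        have : 0 < W / s i * L := by positivity
        simp only [hθ]
        nlinarith
      have h3 : t i ^ 2 * b i ^ 2 / (2 * n) = r ^ 2 * n * θ i ^ 2 / 2 := by
        simp only [ht]
        field_simp
      have h4 : t i * (b i * θ i * r) = r ^ 2 * n * θ i ^ 2 := by
        simp only [ht]
        field_simp
      rw [hr2, one_mul] at h3 h4
      rw [h3] at h
      have h5 : t i * dev D S (smooth (s i) (F i) w) ≤ t i * (b i * θ i * r +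
          (δ * ((t i)⁻¹ * priorMoment D (F i) (b i) (s i) (t i) S) - (t i)⁻¹)) := by
        have h6 : t i * (δ * ((t i)⁻¹ * priorMoment D (F i) (b i) (s i) (t i) S) - (t i)⁻¹) =
            δ * priorMoment D (F i) (b i) (s i) (t i) S - 1 := by
          field_simp
        rw [mul_add, h4, h6]
        linarith
      exact le_of_mul_le_mul_left h5 hti
    refine (Finset.sum_le_sum fun i _ => hi i).trans ?_
    rw [Finset.sum_add_distrib, Finset.sum_sub_distrib, ← Finset.mul_sum]
    have h7 := mul_le_mul_of_nonneg_left hcon hδ.le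
    rw [mul_div_cancel₀ _ hδ.ne'] at h7
    linarith
  · rw [integral_finsetSum _ fun i _ => hYint i]
    refine Finset.sum_le_sum fun i _ => ?_
    rw [integral_const_mul]
    exact mul_le_of_le_one_right (inv_pos.2 (ht0 i)).le
      ((hF i).integral_priorMoment_le D hn (s i) (ht0 i))

end PACBayes

/-! ### Chaining over dyadic bandwidths. -/

section Multiscale

variable {E : Type*} [NormedAddCommGroup E] [InnerProductSpace ℝ E] [FiniteDimensional ℝ E]
  [MeasurableSpace E] [BorelSpace E] {Z : Type*} [MeasurableSpace Z] {n : ℕ}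

/-- Counts the dyadic scales; `3 / 2` bounds `1 / log 2`, and the `1` pays for rounding up. -/
lemma exists_le_two_pow (ρ : ℝ) (hρ : 0 < ρ) :
    ∃ K : ℕ, ρ ≤ 2 ^ K ∧ (K : ℝ) ≤ 1 + 3 / 2 * posLog ρ := by
  have hl : 0.6931471803 < log 2 := log_two_gt_d9
  have hp : 0 ≤ posLog ρ := posLog_nonneg
  have hx : 0 ≤ posLog ρ / log 2 := by positivity
  refine ⟨⌈posLog ρ / log 2⌉₊, ?_, ?_⟩
  · have h := Nat.le_ceil (posLog ρ / log 2)
    rw [div_le_iff₀ (by positivity)] at h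
    rw [← log_le_log_iff hρ (by positivity), log_pow]
    exact (le_max_right 0 (log ρ)).trans h
  · have h := (Nat.ceil_lt_add_one hx).le
    have h2 : posLog ρ / log 2 ≤ 3 / 2 * posLog ρ := by
      rw [div_le_iff₀ (by positivity)]
      nlinarith
    linarith

/-- Writing `P_s` for smoothing, `P_s' - P_s = P_s' (1 - P_s) + P_s (P_s' - 1)`, because smoothings
commute. Both summands are smoothings of small functions, so the PAC-Bayes bound applies to each. -/
lemma IsBddMeas.dev_smooth_sub_dev_smooth {F : E → Z → ℝ} {b : ℝ} (hF : IsBddMeas F b)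
    (D : Measure Z) [IsProbabilityMeasure D] (S : Fin n → Z) (s s' : ℝ) (w : E) :
    dev D S (smooth s' F w) - dev D S (smooth s F w) =
      dev D S (smooth s' (fun u z => F u z - smooth s F u z) w) +
        dev D S (smooth s (fun u z => smooth s' F u z - F u z) w) := by
  have h (s) := (hF.smoothed s).integrable_right D w
  have h' (s s') := ((hF.smoothed s).smoothed s').integrable_right D w
  rw [hF.smooth_sub (hF.smoothed s), (hF.smoothed s').smooth_sub hF, dev_sub (h s') (h' s s'),
    dev_sub (h' s' s) (h s), hF.smooth_comm s s']
  ring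

/-- Uniform deviations of a bounded class that is well approximated by its Gaussian smoothings,
by PAC-Bayes bounds at all dyadic bandwidths. -/
theorem measure_dev_multiscale_le (D : Measure Z) [IsProbabilityMeasure D] (hn : 1 ≤ n)
    {F : E → Z → ℝ} {B a W δ : ℝ} (hF : IsBddMeas F B) (hB : 0 < B) (ha : 0 < a) (hW : 0 < W)
    (hδ : 0 < δ) (hδ' : δ < 1)
    (hsm : ∀ s, 0 < s → ∀ u z, |smooth s F u z - F u z| ≤ a * s) :
    (Measure.pi fun _ : Fin n => D) {S | ¬ ∀ w : E, ‖w‖ ≤ W →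
      dev D S (F w) ≤ a * W * √(1 / n) * (6 + 4 * posLog (B * √n / (a * W))) +
        6 * (B * √(log (1 / δ) / n))} ≤ ENNReal.ofReal δ := by
  have hn' : (0 : ℝ) < n := by exact_mod_cast hn
  have hL : 0 < log (1 / δ) := log_pos (by rw [lt_div_iff₀ hδ]; linarith)
  obtain ⟨K, hK1, hK2⟩ := exists_le_two_pow (B * √n / (a * W)) (by positivity)
  set q := posLog (B * √n / (a * W)) with hq
  have hq0 : 0 ≤ q := posLog_nonneg
  -- At `σ 0` the bias bound `a σ` equals the trivial bound `B`, and the divergence cost `B W / σ 0`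
  -- is just `a W`. By the choice of `K`, the bias bound at `σ K` is at most `a W / √n`.
  set σ : ℕ → ℝ := fun k => B / a * (1 / 2) ^ k with hσ
  have hσ0 : ∀ k, 0 < σ k := fun k => by simp only [hσ]; positivity
  have hσs : ∀ k, σ (k + 1) = σ k / 2 := fun k => by simp only [hσ, pow_succ]; ring
  have hsm' : ∀ s, 0 < s → ∀ u z, |F u z - smooth s F u z| ≤ a * s := fun s hs u z => by
    rw [abs_sub_comm]; exact hsm s hs u z
  set r := √(1 / (n : ℝ)) with hr
  have hr0 : 0 < r := by positivity
  have hrn : r * √n = 1 := by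
    rw [hr, ← sqrt_mul (by positivity), one_div, inv_mul_cancel₀ hn'.ne', sqrt_one]
  have hσK : a * σ K ≤ a * W * r := by
    have h1 : B * √n ≤ 2 ^ K * (a * W) := by rwa [div_le_iff₀ (by positivity)] at hK1
    have h2 : a * σ K = B / 2 ^ K := by simp only [hσ]; field_simp; simp
    rw [h2, div_le_iff₀ (by positivity)]
    calc B = B * √n * r := by rw [mul_assoc, mul_comm _ r, hrn, mul_one]
      _ ≤ 2 ^ K * (a * W) * r := by gcongr
      _ = _ := by ring
  let ψ : Option (Fin K ⊕ Fin K) → E → Z → ℝ := fun i => i.elim F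
    (Sum.elim (fun k u z => F u z - smooth (σ k) F u z)
      (fun k u z => smooth (σ (k + 1)) F u z - F u z))
  let b : Option (Fin K ⊕ Fin K) → ℝ := fun i => i.elim B
    (Sum.elim (fun k => a * σ k) (fun k => a * σ (k + 1)))
  let s : Option (Fin K ⊕ Fin K) → ℝ := fun i => i.elim (σ 0)
    (Sum.elim (fun k => σ (k + 1)) (fun k => σ k))
  have hψ : ∀ i, IsBddMeas (ψ i) (b i) := by
    rintro (_ | k | k)
    · exact hF
    · exact hF.sub (hF.smoothed _) (hsm' _ (hσ0 k))
    · exact (hF.smoothed _).sub hF (hsm _ (hσ0 (k + 1)))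
  have hb : ∀ i, 0 < b i := by
    rintro (_ | k | k)
    · exact hB
    · exact mul_pos ha (hσ0 k)
    · exact mul_pos ha (hσ0 (k + 1))
  have hs : ∀ i, 0 < s i := by
    rintro (_ | k | k)
    · exact hσ0 0
    · exact hσ0 (k + 1)
    · exact hσ0 k
  refine (measure_mono fun S hS => ?_).trans
    (measure_sum_dev_smooth_le D hn ψ b s hψ hb hs hW hδ hδ')
  simp only [Set.mem_ofPred_eq] at hS ⊢
  refine fun hgood => hS fun w hw => ?_
  have hg := hgood w hw
  rw [← hr] at hg
  set L := √(2 * log (1 / δ)) with hLdef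
  have hLr : L * r ≤ 3 / 2 * √(log (1 / δ) / n) := by
    have h2 : √2 ≤ 3 / 2 := by rw [sqrt_le_iff]; norm_num
    rw [hLdef, hr, div_eq_mul_one_div (log (1 / δ)), sqrt_mul (by norm_num), sqrt_mul hL.le,
      mul_assoc]
    gcongr
  simp only [Fintype.sum_option, Fintype.sum_sum_type, ψ, b, s, Option.elim_none,
    Option.elim_some, Sum.elim_inl, Sum.elim_inr] at hg
  rw [← Finset.sum_add_distrib, ← Finset.sum_add_distrib] at hg
  have hlhs : ∑ k : Fin K, (dev D S (smooth (σ (k + 1)) (fun u z => F u z - smooth (σ k) F u z) w) +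
      dev D S (smooth (σ k) (fun u z => smooth (σ (k + 1)) F u z - F u z) w)) =
      dev D S (smooth (σ K) F w) - dev D S (smooth (σ 0) F w) := by
    rw [← Finset.sum_range_sub (fun k => dev D S (smooth (σ k) F w)), ← Fin.sum_univ_eq_sum_range
      (fun k => dev D S (smooth (σ (k + 1)) F w) - dev D S (smooth (σ k) F w))]
    refine Finset.sum_congr rfl fun k _ => ?_
    rw [hF.dev_smooth_sub_dev_smooth D S]
  -- The ratios of adjacent bandwidths give `2 + 1/2 = 5/2` per scale, and the confidence terms form
  -- a geometric series with total at most `3 B`.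
  have hrhs : ∑ k : Fin K, (a * σ k * (W / σ (k + 1) + L) * r +
      a * σ (k + 1) * (W / σ k + L) * r) ≤ K * (5 / 2 * (a * W * r)) + 3 * B * (L * r) := by
    have hk : ∀ k : Fin K, a * σ k * (W / σ (k + 1) + L) * r +
        a * σ (k + 1) * (W / σ k + L) * r =
        5 / 2 * (a * W * r) + 3 / 2 * B * (L * r) * (1 / 2) ^ (k : ℕ) := by
      intro k
      have h1 := hσ0 k
      have h2 : a * σ k = B * (1 / 2) ^ (k : ℕ) := by simp only [hσ]; field_simp
      calc _ = 5 / 2 * (a * W * r) + 3 / 2 * (a * σ k) * (L * r) := by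
            rw [hσs]; field_simp; ring
        _ = _ := by rw [h2]; ring
    rw [Finset.sum_congr rfl fun k _ => hk k, Finset.sum_add_distrib,
      ← Finset.mul_sum _ _ (3 / 2 * B * (L * r)), Fin.sum_univ_eq_sum_range (fun k => ((1 : ℝ) / 2) ^ k) K]
    have hgeo := sum_geometric_two_le K
    have hpos : 0 ≤ 3 / 2 * B * (L * r) := by positivity
    have := mul_le_mul_of_nonneg_left hgeo hpos
    simp only [Finset.sum_const, Finset.card_univ, Fintype.card_fin, nsmul_eq_mul]
    linarith
  have htop : B * (W / σ 0 + L) * r = a * W * r + B * (L * r) := by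
    simp only [hσ]; field_simp
  -- The last smoothing is removed deterministically, once in the expectation and once in the sample
  -- mean.
  have hbias : dev D S (F w) - dev D S (smooth (σ K) F w) ≤ 2 * (a * σ K) := by
    rw [← dev_sub (hF.integrable_right D w) ((hF.smoothed _).integrable_right D w)]
    exact le_of_abs_le (abs_dev_le hn (hsm' _ (hσ0 K) w) S)
  rw [hlhs, htop] at hg
  have hK3 : (K : ℝ) * (5 / 2 * (a * W * r)) ≤ (1 + 3 / 2 * q) * (5 / 2 * (a * W * r)) := by
    gcongr
  have hBL : 4 * B * (L * r) ≤ 4 * B * (3 / 2 * √(log (1 / δ) / n)) := by gcongr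
  have hqr : 0 ≤ a * W * r * q := by positivity
  have har : 0 ≤ a * W * r := by positivity
  linarith

end Multiscale

/-! ### Linear scores, the clipped loss and the uniform bound. -/

section Loss

variable {m d n : ℕ} {G W R B : ℝ} {Y : Set (Fin m → ℝ)} {φ : (Fin m → ℝ) → Y → ℝ}

/-- A nonnegative measurable loss, `G`-Lipschitz in the scores for the sup norm, and bounded by `B`
on the score vectors of the weight ball. -/
structure IsLipschitzBoundedLoss (d : ℕ) (G W R B : ℝ) (φ : (Fin m → ℝ) → Y → ℝ) : Prop where
  meas : Measurable (Function.uncurry φ)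
  nonneg : ∀ s y, 0 ≤ φ s y
  lip : ∀ y s s', |φ s y - φ s' y| ≤ G * ‖s - s'‖
  bdd : ∀ X ∈ inputSpace m d R, ∀ y : Y, ∀ w ∈ weightBall d W, φ (score X w) y ≤ B

lemma score_sub (X : Fin m → EuclideanSpace ℝ (Fin d)) (w w' : EuclideanSpace ℝ (Fin d)) :
    score X w - score X w' = score X (w - w') := by
  funext j
  simp [score, inner_sub_right]

lemma score_smul (X : Fin m → EuclideanSpace ℝ (Fin d)) (s : ℝ) (w : EuclideanSpace ℝ (Fin d)) :
    score X (s • w) = s • score X w := by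
  funext j
  simp [score, inner_smul_right]

lemma norm_score_le {X : Fin m → EuclideanSpace ℝ (Fin d)} (hX : X ∈ inputSpace m d R) (hR : 0 ≤ R)
    (w : EuclideanSpace ℝ (Fin d)) : ‖score X w‖ ≤ R * ‖w‖ :=
  (pi_norm_le_iff_of_nonneg (by positivity)).2 fun j =>
    (norm_inner_le_norm _ _).trans (mul_le_mul_of_nonneg_right (hX j) (norm_nonneg w))

lemma zero_mem_weightBall (hW : 0 ≤ W) : (0 : EuclideanSpace ℝ (Fin d)) ∈ weightBall d W := by
  simpa [weightBall] using hW

lemma exists_isBallMinimizer {L : EuclideanSpace ℝ (Fin d) → ℝ} {c : ℝ} (hW : 0 ≤ W) (hc : 0 ≤ c)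
    (hL : ∀ w ∈ weightBall d W, ∀ w' ∈ weightBall d W, |L w - L w'| ≤ c * ‖w - w'‖) :
    ∃ w, IsBallMinimizer W L w := by
  have hball : weightBall d W = Metric.closedBall 0 W := by
    ext w; simp [weightBall]
  have hcont : ContinuousOn L (weightBall d W) :=
    (LipschitzOnWith.of_dist_le_mul (K := ⟨c, hc⟩) fun w hw w' hw' => by
      rw [dist_eq_norm, dist_eq_norm]; exact hL w hw w' hw').continuousOn
  obtain ⟨w, hw, hmin⟩ := (hball ▸ isCompact_closedBall 0 W :
    IsCompact (weightBall d W)).exists_isMinOn ⟨0, zero_mem_weightBall hW⟩ hcont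
  exact ⟨w, hw, hmin⟩

lemma risk_sub_empRisk (D : Measure (LabelledExample m d R Y)) (S : Fin n → LabelledExample m d R Y)
    (w : EuclideanSpace ℝ (Fin d)) :
    risk φ D w - empRisk φ S w = dev D S (lossAt φ w) := rfl

/-- The loss clipped at the level `B`. -/
noncomputable def clippedLoss (φ : (Fin m → ℝ) → Y → ℝ) (R B : ℝ)
    (w : EuclideanSpace ℝ (Fin d)) (z : LabelledExample m d R Y) : ℝ :=
  min (lossAt φ w z) B

namespace IsLipschitzBoundedLoss

variable (hφ : IsLipschitzBoundedLoss d G W R B φ)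
include hφ

lemma measurable_lossAt :
    Measurable (Function.uncurry (lossAt φ :
      EuclideanSpace ℝ (Fin d) → LabelledExample m d R Y → ℝ)) := by
  refine hφ.meas.comp (Measurable.prodMk ?_ (measurable_snd.comp measurable_snd))
  refine measurable_pi_lambda _ fun j => Measurable.inner ?_ measurable_fst
  exact (measurable_pi_apply j).comp
    (measurable_subtype_coe.comp (measurable_fst.comp measurable_snd))

lemma measurable_lossAt_right (w : EuclideanSpace ℝ (Fin d)) :
    Measurable (lossAt φ w : LabelledExample m d R Y → ℝ) :=
  hφ.measurable_lossAt.comp measurable_prodMk_left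

lemma abs_lossAt_sub_le (z : LabelledExample m d R Y) (w w' : EuclideanSpace ℝ (Fin d)) :
    |lossAt φ w z - lossAt φ w' z| ≤ G * ‖score z.1.1 (w - w')‖ := by
  rw [← score_sub]
  exact hφ.lip _ _ _

lemma abs_lossAt_sub_le_norm (hG : 0 ≤ G) (hR : 0 ≤ R) (z : LabelledExample m d R Y)
    (w w' : EuclideanSpace ℝ (Fin d)) :
    |lossAt φ w z - lossAt φ w' z| ≤ G * R * ‖w - w'‖ := by
  refine (hφ.abs_lossAt_sub_le z w w').trans ?_
  rw [mul_assoc]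
  exact mul_le_mul_of_nonneg_left (norm_score_le z.1.2 hR _) hG

lemma abs_lossAt_le {w : EuclideanSpace ℝ (Fin d)} (hw : w ∈ weightBall d W)
    (z : LabelledExample m d R Y) : |lossAt φ w z| ≤ B := by
  rw [lossAt, abs_of_nonneg (hφ.nonneg _ _)]
  exact hφ.bdd _ z.1.2 _ w hw

lemma bound_nonneg (hW : 0 ≤ W) (z : LabelledExample m d R Y) : 0 ≤ B :=
  (abs_nonneg _).trans (hφ.abs_lossAt_le (zero_mem_weightBall hW) z)

lemma abs_risk_sub_le (hG : 0 ≤ G) (hR : 0 ≤ R) (D : Measure (LabelledExample m d R Y))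
    [IsProbabilityMeasure D] {w w' : EuclideanSpace ℝ (Fin d)} (hw : w ∈ weightBall d W)
    (hw' : w' ∈ weightBall d W) : |risk φ D w - risk φ D w'| ≤ G * R * ‖w - w'‖ := by
  unfold risk
  rw [← integral_sub (integrable_of_abs_le (hφ.measurable_lossAt_right w) (hφ.abs_lossAt_le hw))
    (integrable_of_abs_le (hφ.measurable_lossAt_right w') (hφ.abs_lossAt_le hw'))]
  exact abs_integral_le_of_abs_le fun z => hφ.abs_lossAt_sub_le_norm hG hR z w w'

lemma abs_empRisk_sub_le (hG : 0 ≤ G) (hR : 0 ≤ R) (hn : 1 ≤ n)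
    (S : Fin n → LabelledExample m d R Y) (w w' : EuclideanSpace ℝ (Fin d)) :
    |empRisk φ S w - empRisk φ S w'| ≤ G * R * ‖w - w'‖ := by
  unfold empRisk
  rw [← mul_sub, ← Finset.sum_sub_distrib]
  exact abs_mean_le hn (f := fun z => lossAt φ w z - lossAt φ w' z)
    (fun z => hφ.abs_lossAt_sub_le_norm hG hR z w w') S

/-- Gaussian perturbations leave the weight ball, where the loss may exceed `B`. Clipping restores
the bound everywhere, keeps the Lipschitz estimate and changes nothing on the ball. -/
lemma isBddMeas_clippedLoss (hB : 0 ≤ B) :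
    IsBddMeas (clippedLoss φ R B : EuclideanSpace ℝ (Fin d) → _) B := by
  refine ⟨hφ.measurable_lossAt.min measurable_const, fun u z => ?_⟩
  rw [clippedLoss, lossAt, abs_of_nonneg (le_min (hφ.nonneg _ _) hB)]
  exact min_le_right _ _

lemma clippedLoss_eq {w : EuclideanSpace ℝ (Fin d)} (hw : w ∈ weightBall d W) :
    clippedLoss φ R B w = lossAt φ w :=
  funext fun z => min_eq_left (le_of_abs_le (hφ.abs_lossAt_le hw z))

/-- Gaussian smoothing perturbs the clipped loss by at most the expected sup norm of a Gaussian
score vector. -/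
lemma abs_smooth_clippedLoss_sub_le [NeZero m] (hG : 0 ≤ G) (hR : 0 < R) (hB : 0 ≤ B) {l : ℝ}
    (hl : 0 < l) (hml : log (2 * m) ≤ l) {s : ℝ} (hs : 0 < s) (u : EuclideanSpace ℝ (Fin d))
    (z : LabelledExample m d R Y) :
    |smooth s (clippedLoss φ R B) u z - clippedLoss φ R B u z| ≤ G * (R * √(2 * l)) * s := by
  have hint := (hφ.isBddMeas_clippedLoss hB).integrable_left s u z
  have hg := integrable_norm_inner z.1.1
  have heq : smooth s (clippedLoss φ R B) u z - clippedLoss φ R B u z =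
      ∫ g, (clippedLoss φ R B (u + s • g) z - clippedLoss φ R B u z) ∂gauss _ := by
    rw [integral_sub hint (integrable_const _)]
    simp [smooth]
  have hpt : ∀ g, |clippedLoss φ R B (u + s • g) z - clippedLoss φ R B u z| ≤
      G * s * ‖fun j => (inner ℝ (z.1.1 j) g : ℝ)‖ := fun g => by
    refine (abs_inf_sub_inf_le_abs _ _ _).trans ((hφ.abs_lossAt_sub_le z _ _).trans (le_of_eq ?_))
    rw [add_sub_cancel_left, score_smul, norm_smul, norm_of_nonneg hs.le, mul_assoc]
    rfl
  rw [heq]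
  calc _ ≤ ∫ g, G * s * ‖fun j => (inner ℝ (z.1.1 j) g : ℝ)‖ ∂gauss _ :=
        (abs_integral_le_integral_abs).trans
          (integral_mono (hint.sub (integrable_const _)).abs (hg.const_mul _) hpt)
    _ ≤ G * s * (R * √(2 * l)) := by
        rw [integral_const_mul]
        exact mul_le_mul_of_nonneg_left
          (integral_norm_inner_le z.1.1 hR z.1.2 hl (by simpa using hml)) (by positivity)
    _ = _ := by ring

end IsLipschitzBoundedLoss

lemma mul_sqrt_le_complexityTerm {δ : ℝ} (hG : 0 ≤ G) (hW : 0 ≤ W) (hR : 0 ≤ R) :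
    B * √(log (1 / δ) / n) ≤ complexityTerm m n G W R B δ := by
  have := posLog_nonneg (x := B * √(n : ℝ) / (G * W * R * √(log (3 * m * n))))
  unfold complexityTerm
  exact le_add_of_nonneg_left (by positivity)

/-- The uniform deviation bound. -/
theorem measure_risk_gt_le (hm : 1 ≤ m) (hn : 1 ≤ n) {δ : ℝ} (hG : 0 ≤ G) (hW : 0 ≤ W)
    (hR : 0 ≤ R) (hδ : 0 < δ) (hδ' : δ < 1) (hφ : IsLipschitzBoundedLoss d G W R B φ)
    (D : Measure (LabelledExample m d R Y)) [IsProbabilityMeasure D] :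
    (Measure.pi fun _ : Fin n => D) {S | ¬ ∀ w ∈ weightBall d W,
      risk φ D w ≤ empRisk φ S w + 9 * complexityTerm m n G W R B δ} ≤ ENNReal.ofReal δ := by
  have hn' : (1 : ℝ) ≤ n := by exact_mod_cast hn
  have hm' : (1 : ℝ) ≤ m := by exact_mod_cast hm
  have : NeZero m := ⟨by omega⟩
  obtain ⟨z⟩ : Nonempty (LabelledExample m d R Y) := nonempty_of_isProbabilityMeasure D
  have hB := hφ.bound_nonneg hW z
  have hBr : 0 ≤ B * √(log (1 / δ) / n) := by positivity
  have hcomp := mul_sqrt_le_complexityTerm (m := m) (n := n) (B := B) (δ := δ) hG hW hR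
  have hs2 : √2 ≤ 3 / 2 := by rw [sqrt_le_iff]; norm_num
  -- If the loss is constant in `w`, Hoeffding's inequality for one function suffices. This covers
  -- `B = 0` and `G R W = 0`, so all parameters are positive afterwards.
  by_cases hdeg : ∀ w ∈ weightBall d W, (lossAt φ w : LabelledExample m d R Y → ℝ) = lossAt φ 0
  · refine (measure_mono fun S hS => ?_).trans (measure_dev_gt_le D hn
      (hφ.measurable_lossAt_right 0) (hφ.abs_lossAt_le (zero_mem_weightBall hW)) hB hδ hδ')
    simp only [Set.mem_ofPred_eq] at hS ⊢
    by_contra hcon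
    refine hS fun w hw => ?_
    have h := risk_sub_empRisk (φ := φ) D S w
    rw [hdeg w hw] at h
    have := mul_le_mul_of_nonneg_right hs2 hBr
    linarith
  have hB0 : 0 < B := by
    refine hB.lt_of_ne fun h0 => hdeg fun w hw => funext fun z => ?_
    have h1 := hφ.abs_lossAt_le hw z
    have h2 := hφ.abs_lossAt_le (zero_mem_weightBall hW) z
    rw [← h0, abs_nonpos_iff] at h1 h2
    rw [h1, h2]
  have hGWR : 0 < G * R * W := by
    refine lt_of_le_of_ne (by positivity) fun h0 => hdeg fun w hw => funext fun z => ?_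
    have h1 := hφ.abs_lossAt_sub_le_norm hG hR z w 0
    have h2 : G * R * ‖w - 0‖ ≤ G * R * W := by
      rw [sub_zero]; exact mul_le_mul_of_nonneg_left hw (by positivity)
    rw [← h0] at h2
    exact sub_eq_zero.1 (abs_nonpos_iff.1 (h1.trans h2))
  have hG0 : 0 < G := hG.lt_of_ne (by rintro rfl; simp at hGWR)
  have hR0 : 0 < R := hR.lt_of_ne (by rintro rfl; simp at hGWR)
  have hW0 : 0 < W := hW.lt_of_ne (by rintro rfl; simp at hGWR)
  set l := log (3 * m * n) with hl
  have hl0 : 0 < l := log_pos (by nlinarith)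
  have hml : log (2 * m) ≤ l := log_le_log (by positivity) (by nlinarith)
  have hs1 : 1 ≤ √2 := one_le_sqrt.2 (by norm_num)
  refine (measure_mono fun S hS => ?_).trans (measure_dev_multiscale_le D hn
    (hφ.isBddMeas_clippedLoss hB) hB0 (a := G * (R * √(2 * l))) (by positivity) hW0 hδ hδ'
    fun s hs u z => hφ.abs_smooth_clippedLoss_sub_le hG hR0 hB hl0 hml hs u z)
  simp only [Set.mem_ofPred_eq] at hS ⊢
  refine fun hgood => hS fun w hw => ?_
  have h := hgood w hw
  rw [hφ.clippedLoss_eq hw, ← risk_sub_empRisk] at h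
  have ha : G * (R * √(2 * l)) * W = √2 * (G * W * R * √l) := by
    rw [sqrt_mul (by norm_num)]; ring
  rw [ha] at h
  have hA : 0 < G * W * R * √l := by positivity
  have hlog : posLog (B * √n / (√2 * (G * W * R * √l))) ≤ posLog (B * √n / (G * W * R * √l)) := by
    refine posLog_le_posLog (by positivity) ?_
    exact div_le_div_of_nonneg_left (by positivity) hA (le_mul_of_one_le_left hA.le hs1)
  -- Raising `4` to `6` lets the common factor out, and `3/2 * 6 = 9` is the final constant.
  have h1 : √2 * (G * W * R * √l) * √(1 / n) * (6 + 4 * posLog (B * √n / (√2 * (G * W * R * √l)))) ≤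
      3 / 2 * (G * W * R * √l) * √(1 / n) * (6 + 6 * posLog (B * √n / (G * W * R * √l))) := by
    have := posLog_nonneg (x := B * √n / (G * W * R * √l))
    have : 0 ≤ posLog (B * √n / (√2 * (G * W * R * √l))) := posLog_nonneg
    gcongr
    norm_num
  have h2 : complexityTerm m n G W R B δ = G * W * R * √l * √(1 / n) *
      (1 + posLog (B * √n / (G * W * R * √l))) + B * √(log (1 / δ) / n) := by
    rw [complexityTerm, ← hl]; ring
  rw [h2]
  linarith

end Loss

end LTR

/-! ### Uniform bound and excess risk. -/

theorem mainTheorem1 :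
    ∃ C : ℝ, 0 < C ∧
      ∀ (m d n : ℕ) (_hm : 1 ≤ m) (_hn : 1 ≤ n)
        (G W R B δ : ℝ) (_hG : 0 ≤ G) (_hW : 0 ≤ W) (_hR : 0 ≤ R) (_hδ : 0 < δ) (_hδ' : δ < 1)
        (Y : Set (Fin m → ℝ))
        (φ : (Fin m → ℝ) → Y → ℝ)
        (_hφmeas : Measurable (Function.uncurry φ))
        (_hφnonneg : ∀ s y, 0 ≤ φ s y)
        -- `‖s - s'‖` is the sup norm on `Fin m → ℝ`
        (_hφlip : ∀ y s s', |φ s y - φ s' y| ≤ G * ‖s - s'‖)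
        (_hφbdd : ∀ X ∈ LTR.inputSpace m d R, ∀ y : Y, ∀ w ∈ LTR.weightBall d W,
          φ (LTR.score X w) y ≤ B)
        (D : MeasureTheory.Measure (LTR.LabelledExample m d R Y))
        (_hD : MeasureTheory.IsProbabilityMeasure D),
        -- uniform bound: the exceptional set of samples has (outer) probability at most `δ`
        (MeasureTheory.Measure.pi fun _ : Fin n => D)
            {S | ¬ ∀ w ∈ LTR.weightBall d W,
              LTR.risk φ D w ≤ LTR.empRisk φ S w + C * LTR.complexityTerm m n G W R B δ}
          ≤ ENNReal.ofReal δ ∧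
        -- the minimizers in the excess risk bound exist
        (∃ wstar, LTR.IsBallMinimizer W (LTR.risk φ D) wstar) ∧
        (∀ S : Fin n → LTR.LabelledExample m d R Y,
          ∃ what, LTR.IsBallMinimizer W (LTR.empRisk φ S) what) ∧
        -- excess risk bound, for every choice of the minimizers
        (MeasureTheory.Measure.pi fun _ : Fin n => D)
            {S | ¬ ∀ what wstar, LTR.IsBallMinimizer W (LTR.empRisk φ S) what →
              LTR.IsBallMinimizer W (LTR.risk φ D) wstar →
              LTR.risk φ D what ≤ LTR.risk φ D wstar + C * LTR.complexityTerm m n G W R B δ}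
          ≤ ENNReal.ofReal (2 * δ) := by
  -- `9` from the uniform bound plus `2 ≥ √2` from Hoeffding's inequality.
  refine ⟨11, by norm_num, ?_⟩
  intro m d n hm hn G W R B δ hG hW hR hδ hδ' Y φ hmeas hnonneg hlip hbdd D hD
  have hφ : LTR.IsLipschitzBoundedLoss d G W R B φ := ⟨hmeas, hnonneg, hlip, hbdd⟩
  obtain ⟨z⟩ : Nonempty (LTR.LabelledExample m d R Y) :=
    MeasureTheory.nonempty_of_isProbabilityMeasure D
  have hB := hφ.bound_nonneg hW z
  have hBr : 0 ≤ B * √(Real.log (1 / δ) / n) := by positivity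
  have hcomp := LTR.mul_sqrt_le_complexityTerm (m := m) (n := n) (B := B) (δ := δ) hG hW hR
  have hs2 : √2 ≤ 2 := by rw [Real.sqrt_le_iff]; norm_num
  have hunif := LTR.measure_risk_gt_le hm hn hG hW hR hδ hδ' hφ D
  obtain ⟨w₀, hw₀⟩ := LTR.exists_isBallMinimizer hW (mul_nonneg hG hR) fun w hw w' hw' =>
    hφ.abs_risk_sub_le hG hR D hw hw'
  refine ⟨?_, ⟨w₀, hw₀⟩, fun S => LTR.exists_isBallMinimizer hW (mul_nonneg hG hR)
    fun w _ w' _ => hφ.abs_empRisk_sub_le hG hR hn S w w', ?_⟩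
  · refine (MeasureTheory.measure_mono fun S hS => ?_).trans hunif
    simp only [Set.mem_ofPred_eq] at hS ⊢
    refine fun hgood => hS fun w hw => ?_
    linarith [hgood w hw]
  -- The negated loss gives the lower-tail direction: the empirical risk of `w₀` is not much above
  -- its risk. Fixing `w₀` suffices, since all population minimizers have the same risk.
  · have hsingle := LTR.measure_dev_gt_le (n := n) D hn (hφ.measurable_lossAt_right w₀).neg
      (fun z => (abs_neg _).trans_le (hφ.abs_lossAt_le hw₀.1 z)) hB hδ hδ'
    rw [two_mul, ENNReal.ofReal_add hδ.le hδ.le]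
    refine (MeasureTheory.measure_mono fun S hS => ?_).trans
      ((MeasureTheory.measure_union_le _ _).trans (add_le_add hunif hsingle))
    by_contra hcon
    rw [Set.mem_union, not_or] at hcon
    obtain ⟨h1, h2⟩ := hcon
    simp only [Set.mem_ofPred_eq, not_not, not_lt] at hS h1 h2
    refine hS fun what wstar hwhat hwstar => ?_
    have h3 := h1 what hwhat.1
    have h4 : LTR.empRisk φ S what ≤ LTR.empRisk φ S w₀ := hwhat.2 hw₀.1
    have h5 : LTR.risk φ D w₀ ≤ LTR.risk φ D wstar := hw₀.2 hwstar.1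
    have h6 := LTR.risk_sub_empRisk (φ := φ) D S w₀
    have h7 : LTR.dev D S (-LTR.lossAt φ w₀) = -LTR.dev D S (LTR.lossAt φ w₀) := by
      simp only [LTR.dev, Pi.neg_apply, MeasureTheory.integral_neg, Finset.sum_neg_distrib]
      ring
    have h8 := mul_le_mul_of_nonneg_right hs2 hBr
    have h2' : LTR.dev D S (-LTR.lossAt φ w₀) ≤ √2 * (B * √(Real.log (1 / δ) / n)) := h2
    linarith
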